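/- Let $k$ be an algebraically closed field of characteristic zero. For a commutative $k$-algebra $R$, a $k$-algebra automorphism $\sigma$ of $R$ and $a\in R$, let $R(\sigma,a)$ denote the generalized Weyl algebra (GWA) of degree one, that is, the $k$-algebra generated over $R$ by two generators $x,y$ subject to the relations $xr=\sigma(r)x$ and $yr=\sigma^{-1}(r)y$ for all $r\in R$, $xy=\sigma(a)$, and $yx=a$. For $0\neq a\in k[h]$ the classical GWA is $A(a)=k[h](\sigma_{cl},a)$ with $\sigma_{cl}(h)=h-1$. For $q\in k^*$ and $0\neq a\in k[h]$ the quantum GWA is $A_q(a)=k[h](\sigma_q,a)$ with $\sigma_q(h)=qh$, and for $0\neq a\in k[h^{\pm1}]$ the localized quantum GWA is $A'_q(a)=k[h^{\pm1}](\sigma_q,a)$, again with $\sigma_q(h)=qh$. Two $k$-algebras are called Morita equivalent if their categories of left modules are equivalent by a $k$-linear equivalence. Then: 1. A classical GWA $A(a_1)$, with $0\neq a_1\in k[h]$, is never Morita equivalent to a quantum GWA: for every $q\in k^*$, it is Morita equivalent neither to $A_q(a_2)$ for any nonzero $a_2\in k[h]$, nor to $A'_q(a_2)$ for any nonzero $a_2\in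 k[h^{\pm1}]$. 2. Let $q_1,q_2\in k^*$ and let $a_1,a_2\in k[h]$ be nonzero. If $A_{q_1}(a_1)$ and $A_{q_2}(a_2)$ are Morita equivalent, then $\langle q_1\rangle=\langle q_2\rangle$, where $\langle q\rangle$ is the subgroup of $k^*$ generated by $q$. 3. Let $q_1,q_2\in k^*$ and let $a_1,a_2\in k[h^{\pm1}]$ be nonzero, such that the algebras $A'_{q_1}(a_1)$ and $A'_{q_2}(a_2)$ are simple. If they are Morita equivalent, then $q_2=q_1$ or $q_2=q_1^{-1}$. -/

import Mathlib

open scoped Polynomial LaurentPolynomial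

/-- Free generators for a generalized Weyl algebra over `R`: one for every `r : R`, and `x`, `y`. -/
inductive GWAGen (R : Type*) where
  | coeff (r : R) : GWAGen R
  | x : GWAGen R
  | y : GWAGen R

section GWA

variable {k : Type*} [CommRing k] {R : Type*} [CommRing R] [Algebra k R]

/-- The defining relations of `R(σ, a)`. The first four make `R → R(σ, a)` a homomorphism of
unital `k`-algebras, the others are `x r = σ(r) x`, `y r = σ⁻¹(r) y`, `x y = σ(a)`, `y x = a`. -/
inductive GWARel (σ : R ≃ₐ[k] R) (a : R) :
    FreeAlgebra k (GWAGen R) → FreeAlgebra k (GWAGen R) → Prop where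
  | coeff_add (r s : R) : GWARel σ a (FreeAlgebra.ι k (GWAGen.coeff (r + s)))
      (FreeAlgebra.ι k (GWAGen.coeff r) + FreeAlgebra.ι k (GWAGen.coeff s))
  | coeff_mul (r s : R) : GWARel σ a (FreeAlgebra.ι k (GWAGen.coeff (r * s)))
      (FreeAlgebra.ι k (GWAGen.coeff r) * FreeAlgebra.ι k (GWAGen.coeff s))
  | coeff_one : GWARel σ a (FreeAlgebra.ι k (GWAGen.coeff 1)) 1
  | coeff_algebraMap (c : k) : GWARel σ a (FreeAlgebra.ι k (GWAGen.coeff (algebraMap k R c)))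
      (algebraMap k (FreeAlgebra k (GWAGen R)) c)
  | x_coeff (r : R) : GWARel σ a
      (FreeAlgebra.ι k GWAGen.x * FreeAlgebra.ι k (GWAGen.coeff r))
      (FreeAlgebra.ι k (GWAGen.coeff (σ r)) * FreeAlgebra.ι k GWAGen.x)
  | y_coeff (r : R) : GWARel σ a
      (FreeAlgebra.ι k GWAGen.y * FreeAlgebra.ι k (GWAGen.coeff r))
      (FreeAlgebra.ι k (GWAGen.coeff (σ.symm r)) * FreeAlgebra.ι k GWAGen.y)
  | x_y : GWARel σ a (FreeAlgebra.ι k GWAGen.x * FreeAlgebra.ι k GWAGen.y)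
      (FreeAlgebra.ι k (GWAGen.coeff (σ a)))
  | y_x : GWARel σ a (FreeAlgebra.ι k GWAGen.y * FreeAlgebra.ι k GWAGen.x)
      (FreeAlgebra.ι k (GWAGen.coeff a))

/-- The generalized Weyl algebra `R(σ, a)` of degree one: the `k`-algebra generated over `R` by
`x` and `y` subject to `x r = σ(r) x`, `y r = σ⁻¹(r) y`, `x y = σ(a)`, `y x = a`. -/
abbrev GWA (σ : R ≃ₐ[k] R) (a : R) : Type _ := RingQuot (GWARel σ a)

end GWA

section Automorphisms

variable (k : Type*) [Field k]

/-- The automorphism `h ↦ h - 1` of `k[h]`. -/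
noncomputable def sigmaCl : k[X] ≃ₐ[k] k[X] :=
  Polynomial.algEquivOfCompEqX (Polynomial.X - 1) (Polynomial.X + 1) (by simp) (by simp)

variable {k}

/-- The automorphism `h ↦ q h` of `k[h]`. -/
noncomputable def sigmaQ (q : kˣ) : k[X] ≃ₐ[k] k[X] :=
  Polynomial.algEquivOfCompEqX (Polynomial.C (q : k) * Polynomial.X)
    (Polynomial.C ((q⁻¹ : kˣ) : k) * Polynomial.X)
    (by simp [← mul_assoc, ← Polynomial.C_mul]) (by simp [← mul_assoc, ← Polynomial.C_mul])

/-- The endomorphism `h ↦ q h` of `k[h, h⁻¹]`, that is, `h ^ n ↦ q ^ n h ^ n`. -/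
noncomputable def laurentScale (q : kˣ) : k[T;T⁻¹] →ₐ[k] k[T;T⁻¹] :=
  AddMonoidAlgebra.lift k k[T;T⁻¹] ℤ
    { toFun := fun n => ((q ^ n.toAdd : kˣ) : k) • LaurentPolynomial.T n.toAdd
      map_one' := by simp
      map_mul' := fun m n => by
        simp only [toAdd_mul, zpow_add, LaurentPolynomial.T_add, Units.val_mul,
          smul_mul_smul_comm] }

theorem laurentScale_T (q : kˣ) (n : ℤ) :
    laurentScale q (LaurentPolynomial.T n) = ((q ^ n : kˣ) : k) • LaurentPolynomial.T n := by
  exact (AddMonoidAlgebra.lift_single _ _ _).trans (one_smul _ _)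

theorem laurentScale_comp (p q : kˣ) (h : p * q = 1) :
    (laurentScale p).comp (laurentScale q) = AlgHom.id k k[T;T⁻¹] := by
  apply (AddMonoidAlgebra.lift k k[T;T⁻¹] ℤ).symm.injective
  refine MonoidHom.ext fun n => ?_
  change laurentScale p (laurentScale q (LaurentPolynomial.T n.toAdd)) =
    LaurentPolynomial.T n.toAdd
  rw [laurentScale_T, map_smul, laurentScale_T, smul_smul, ← Units.val_mul, ← mul_zpow,
    mul_comm q p, h]
  simp

/-- The automorphism `h ↦ q h` of `k[h, h⁻¹]`. -/
noncomputable def sigmaQLaurent (q : kˣ) : k[T;T⁻¹] ≃ₐ[k] k[T;T⁻¹] :=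
  AlgEquiv.ofAlgHom (laurentScale q) (laurentScale q⁻¹)
    (laurentScale_comp q q⁻¹ (by simp)) (laurentScale_comp q⁻¹ q (by simp))

end Automorphisms

section Families

variable {k : Type*} [Field k]

/-- The classical generalized Weyl algebra `A(a) = k[h](σ_cl, a)`, with `σ_cl(h) = h - 1`. -/
abbrev ClassicalGWA (a : k[X]) : Type _ := GWA (sigmaCl k) a

/-- The quantum generalized Weyl algebra `A_q(a) = k[h](σ_q, a)`, with `σ_q(h) = q h`. -/
abbrev QuantumGWA (q : kˣ) (a : k[X]) : Type _ := GWA (sigmaQ q) a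

/-- The localized quantum generalized Weyl algebra `A'_q(a) = k[h, h⁻¹](σ_q, a)`. -/
abbrev LaurentQuantumGWA (q : kˣ) (a : k[T;T⁻¹]) : Type _ := GWA (sigmaQLaurent q) a

end Families

/-! ### Morita equivalence and endomorphism rings of projective modules -/

section Morita

open CategoryTheory
open scoped ModuleCat.Algebra

universe u

/-! The obstruction is which scalars `c` occur in relations `a * b = c * (b * a)` with `a`, `b`
nonzero. Let `A` and `B` be Morita equivalent domains. Then `Aᵐᵒᵖ` is the endomorphism ring of a
projective `B`-module `P`, and since this ring has no zero divisors, `P` embeds into `B` as a left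
ideal. Let `B` be left Ore, and let `lc` be multiplicative from `B` to a commutative group with
zero, vanishing only at zero. An endomorphism of `P` then changes `lc` by a factor independent of
the point. Such factors commute, so `lc c = 1` for every such scalar of `A`
(`IsMoritaEquivalent.map_algebraMap_eq_one`).

On a GWA, `lc` is the leading coefficient in `x`, then in `h`, read in `kˣ / H`, where `H` contains
the scaling factor of the automorphism (`H` may be trivial in the classical case). The relation `x h
= q₁ h x` with `H = ⟨q₂⟩` gives `q₁ ∈ ⟨q₂⟩`, and symmetry gives equality of the subgroups. Compared
with a classical GWA, trivial `H` forces `q = 1`; the quantum side is then commutative, and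
`IsMoritaEquivalent.mul_comm_of_mul_comm` makes the classical side commutative too, which is absurd.
In the simple Laurent case `q₁` has infinite order, and an infinite cyclic group has only two
generators, inverse to each other. -/

theorem MoritaEquivalence.map_hom_apply {k A B : Type u} [CommRing k] [Ring A] [Algebra k A]
    [Ring B] [Algebra k B] (e : MoritaEquivalence k A B) (M : ModuleCat.{u} A) (f : M ⟶ M) (c : k)
    (hf : ∀ m : M, f.hom m = algebraMap k A c • m) (p : e.eqv.functor.obj M) :
    (e.eqv.functor.map f).hom p = algebraMap k B c • p := by
  have h1 : f = c • 𝟙 M := by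
    apply ModuleCat.hom_ext
    apply LinearMap.ext
    exact hf
  rw [h1, Functor.map_smul, CategoryTheory.Functor.map_id]
  rfl

/-- A Morita equivalence sends the regular module to a projective module whose endomorphism
algebra is the opposite algebra. -/
theorem IsMoritaEquivalent.exists_projective {k A B : Type u} [CommRing k] [Ring A] [Algebra k A]
    [Ring B] [Algebra k B] (h : IsMoritaEquivalent k A B) :
    ∃ (P : Type u) (_ : AddCommGroup P) (_ : Module B P) (F : Aᵐᵒᵖ ≃+* Module.End B P),
      Module.Projective B P ∧
        ∀ (c : k) (p : P), F (.op (algebraMap k A c)) p = algebraMap k B c • p := by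
  obtain ⟨e⟩ := h.cond
  let Q : ModuleCat.{u} A := ModuleCat.of A A
  let P : ModuleCat.{u} B := e.eqv.functor.obj Q
  let E : End Q ≃+* End P :=
    { e.eqv.fullyFaithfulFunctor.mulEquivEnd Q with
      map_add' := fun _ _ => e.eqv.functor.map_add }
  -- Endomorphisms of the left regular module are right multiplications, hence the opposite ring.
  let F : Aᵐᵒᵖ ≃+* Module.End B P := (RingEquiv.moduleEndSelf A).trans
    ((ModuleCat.endRingEquiv Q).symm.trans (E.trans (ModuleCat.endRingEquiv P)))
  refine ⟨P, inferInstance, inferInstance, F, ?_, fun c p => ?_⟩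
  · have : Projective Q := (IsProjective.iff_projective A).mp inferInstance
    have : Projective P := (e.eqv.map_projective_iff Q).mpr this
    exact (IsProjective.iff_projective P).mpr this
  · exact e.map_hom_apply Q _ c (fun m => (Algebra.commutes c _).symm) p

end Morita

/-! ### Projective modules as left ideals, and their endomorphisms -/

section ProjectiveEnd

/-- A projective module over a domain whose endomorphism ring has no zero divisors embeds into
the regular module. -/
theorem Module.Projective.exists_injective_of_noZeroDivisors_end {B P : Type*} [Ring B]
    [NoZeroDivisors B] [AddCommGroup P] [Module B P] [Nontrivial P] (hP : Module.Projective B P)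
    [NoZeroDivisors (Module.End B P)] : ∃ φ : P →ₗ[B] B, Function.Injective φ := by
  obtain ⟨s, hs⟩ := hP
  have hs0 : ∀ p, s p = 0 → p = 0 := fun p hp => by rw [← hs p, hp, map_zero]
  obtain ⟨p₀, hp₀⟩ := exists_ne (0 : P)
  obtain ⟨i, hi⟩ := Finsupp.ne_iff.mp fun h => hp₀ (hs0 p₀ h)
  -- One nonzero coordinate of the splitting into a free module already suffices.
  let φ : P →ₗ[B] B := Finsupp.lapply i ∘ₗ s
  refine ⟨φ, (injective_iff_map_eq_zero φ).mpr fun p hp => ?_⟩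
  -- For `φ p = 0` the endomorphism `q ↦ φ q • p` squares to zero, so it vanishes; its value at `p₀`
  -- then kills every coordinate of `p`.
  have he : φ.smulRight p * φ.smulRight p = 0 := by
    ext q
    simp [hp]
  have he0 : φ.smulRight p = 0 := mul_self_eq_zero.mp he
  have h0 : φ p₀ • p = 0 := by simpa using LinearMap.congr_fun he0 p₀
  refine hs0 p (Finsupp.ext fun j => ?_)
  have hj : φ p₀ * s p j = 0 := by
    simpa using DFunLike.congr_fun (congrArg s h0) j
  exact (mul_eq_zero.mp hj).resolve_left hi

/-- A multiplicative function on a left Ore domain extends to the endomorphisms of any left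
ideal. -/
theorem Module.End.map_apply_mul_comm {B P Γ : Type*} [Ring B] [AddCommGroup P] [Module B P]
    [CommGroupWithZero Γ] (lc : B →*₀ Γ) (hlc : ∀ b, lc b = 0 → b = 0)
    (hore : ∀ b c : B, b ≠ 0 → c ≠ 0 → ∃ s t : B, s ≠ 0 ∧ s * b = t * c)
    (φ : P →ₗ[B] B) (hφ : Function.Injective φ) (f : Module.End B P) {p q : P} (hp : p ≠ 0)
    (hq : q ≠ 0) : lc (φ (f p)) * lc (φ q) = lc (φ (f q)) * lc (φ p) := by
  have hφ0 : ∀ {r : P}, r ≠ 0 → lc (φ r) ≠ 0 := fun hr h =>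
    hr (hφ (by rw [hlc _ h, map_zero]))
  obtain ⟨s, t, hs, hst⟩ := hore (φ p) (φ q) (fun h => hp (hφ (by rw [h, map_zero])))
    (fun h => hq (hφ (by rw [h, map_zero])))
  -- Applying `f` to a common multiple of `p` and `q` compares the factors of `f` at the two points.
  have hpq : s • p = t • q := hφ (by simpa using hst)
  have hf : s * φ (f p) = t * φ (f q) := by
    simpa using congrArg (fun r => φ (f r)) hpq
  have h1 := congrArg lc hst
  have h2 := congrArg lc hf
  rw [map_mul, map_mul] at h1 h2
  have hs0 : lc s ≠ 0 := fun h => hs (hlc s h)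
  have ht0 : lc t ≠ 0 := fun h => mul_ne_zero hs0 (hφ0 hp) (by rw [h1, h, zero_mul])
  apply mul_left_cancel₀ (mul_ne_zero hs0 ht0)
  calc lc s * lc t * (lc (φ (f p)) * lc (φ q))
      = (lc s * lc (φ (f p))) * (lc t * lc (φ q)) := mul_mul_mul_comm _ _ _ _
    _ = (lc t * lc (φ (f q))) * (lc s * lc (φ p)) := by rw [h1, h2]
    _ = lc s * lc t * (lc (φ (f q)) * lc (φ p)) := by
      rw [mul_mul_mul_comm, mul_comm (lc t)]

end ProjectiveEnd

/-! ### Invariants of Morita equivalent domains -/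

section Morita

universe u

variable {k A B : Type u} [CommRing k] [Ring A] [Algebra k A] [Nontrivial A] [NoZeroDivisors A]
  [Ring B] [Algebra k B] [NoZeroDivisors B]

/-- A domain that is Morita equivalent to a domain `B` is opposite to the endomorphism ring of a
left ideal of `B`. -/
theorem IsMoritaEquivalent.exists_injective (h : IsMoritaEquivalent k A B) :
    ∃ (P : Type u) (_ : AddCommGroup P) (_ : Module B P) (F : Aᵐᵒᵖ ≃+* Module.End B P)
      (φ : P →ₗ[B] B), Nontrivial P ∧ Function.Injective φ ∧
        ∀ (c : k) (p : P), F (.op (algebraMap k A c)) p = algebraMap k B c • p := by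
  obtain ⟨P, _, _, F, hP, hF⟩ := h.exists_projective
  have hnt : Nontrivial P := by
    by_contra hsub
    rw [not_nontrivial_iff_subsingleton] at hsub
    exact one_ne_zero (F.injective (LinearMap.ext fun p => Subsingleton.elim _ _) :
      (1 : Aᵐᵒᵖ) = 0)
  have : NoZeroDivisors (Module.End B P) :=
    MulEquiv.noZeroDivisors (A := Module.End B P) Aᵐᵒᵖ F.symm.toMulEquiv
  obtain ⟨φ, hφ⟩ := hP.exists_injective_of_noZeroDivisors_end
  exact ⟨P, _, _, F, φ, hnt, hφ, hF⟩

/-- Scalars that occur as commutators in a domain Morita equivalent to a left Ore domain `B` are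
mapped to one by every multiplicative function from `B` to a commutative group with zero. -/
theorem IsMoritaEquivalent.map_algebraMap_eq_one (h : IsMoritaEquivalent k A B)
    {Γ : Type*} [CommGroupWithZero Γ] (lc : B →*₀ Γ) (hlc : ∀ b, lc b = 0 → b = 0)
    (hore : ∀ b c : B, b ≠ 0 → c ≠ 0 → ∃ s t : B, s ≠ 0 ∧ s * b = t * c)
    {a b : A} (ha : a ≠ 0) (hb : b ≠ 0) {c : k} (hab : a * b = algebraMap k A c * (b * a)) :
    lc (algebraMap k B c) = 1 := by
  obtain ⟨P, _, _, F, φ, _, hφ, hF⟩ := h.exists_injective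
  have hφ0 : ∀ {r : P}, r ≠ 0 → lc (φ r) ≠ 0 := fun hr h =>
    hr (hφ (by rw [hlc _ h, map_zero]))
  obtain ⟨p, hp⟩ := exists_ne (0 : P)
  have hF0 : ∀ {x : A}, x ≠ 0 → F (.op x) p ≠ 0 := fun {x} hx hxp => by
    have hz : F (.op x) = 0 := by
      ext q
      by_cases hq : q = 0
      · rw [hq, map_zero, map_zero]
      · have := Module.End.map_apply_mul_comm lc hlc hore φ hφ (F (.op x)) hp hq
        rw [hxp, map_zero, map_zero, zero_mul, eq_comm] at this
        have := hlc _ ((mul_eq_zero.mp this).resolve_right (hφ0 hp))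
        exact hφ (by rw [this, LinearMap.zero_apply, map_zero])
    exact hx (MulOpposite.op_injective (F.injective (by rw [hz, MulOpposite.op_zero, map_zero])))
  have key : F (.op b) (F (.op a) p) = algebraMap k B c • F (.op a) (F (.op b) p) := by
    have := congrArg (fun x => F (.op x) p) hab
    simpa [hF] using this
  -- The factor of each endomorphism is the same at `p` and at the image of `p` under the other one,
  -- so both composites have the same factor, while `key` makes them differ by `c`.
  have h1 := Module.End.map_apply_mul_comm lc hlc hore φ hφ (F (.op b)) (hF0 ha) hp
  have h2 := Module.End.map_apply_mul_comm lc hlc hore φ hφ (F (.op a)) (hF0 hb) hp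
  rw [key, map_smul, smul_eq_mul, map_mul, mul_assoc, h2, mul_comm (lc (φ (F (.op b) p)))] at h1
  exact mul_right_cancel₀ (mul_ne_zero (hφ0 (hF0 ha)) (hφ0 (hF0 hb))) (h1.trans (one_mul _).symm)

/-- A domain that is Morita equivalent to a commutative domain is commutative. -/
theorem IsMoritaEquivalent.mul_comm_of_mul_comm (h : IsMoritaEquivalent k A B)
    (hB : ∀ b c : B, b * c = c * b) (a b : A) : a * b = b * a := by
  obtain ⟨P, _, _, F, φ, _, hφ, -⟩ := h.exists_injective
  have hsymm : ∀ p q : P, φ p • q = φ q • p := fun p q => hφ (by simp [hB])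
  have hcomm : ∀ f g : Module.End B P, g * f = f * g := fun f g => by
    ext p
    by_cases hp : p = 0
    · simp [hp]
    have hp0 : φ p ≠ 0 := fun h => hp (hφ (by rw [h, map_zero]))
    have key : φ p • g (f p) = φ p • f (g p) :=
      calc φ p • g (f p) = φ (f p) • g p := by rw [← map_smul, hsymm p, map_smul]
        _ = φ (g p) • f p := hsymm _ _
        _ = φ p • f (g p) := by rw [← map_smul, hsymm _ p, map_smul]
    exact hφ (mul_left_cancel₀ hp0 (by simpa using congrArg φ key))
  exact MulOpposite.op_injective (F.injective (by simp [hcomm]))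

end Morita

/-! ### Monomial spanning set and skew Laurent representation of a GWA -/

namespace GWA

section Generators

variable {k : Type*} [CommRing k] {R : Type*} [CommRing R] [Algebra k R] (σ : R ≃ₐ[k] R) (a : R)

/-- The canonical homomorphism from the coefficient ring. -/
noncomputable def coeff : R →ₐ[k] GWA σ a :=
  AlgHom.ofLinearMap
    { toFun := fun r => RingQuot.mkAlgHom k (GWARel σ a) (FreeAlgebra.ι k (GWAGen.coeff r))
      map_add' := fun r s => by
        rw [← map_add]; exact RingQuot.mkAlgHom_rel k (GWARel.coeff_add r s)
      map_smul' := fun c r => by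
        rw [Algebra.smul_def, RingQuot.mkAlgHom_rel k (GWARel.coeff_mul _ _), map_mul,
          RingQuot.mkAlgHom_rel k (GWARel.coeff_algebraMap c), AlgHom.commutes, ← Algebra.smul_def]
        rfl }
    ((RingQuot.mkAlgHom_rel k GWARel.coeff_one).trans (map_one _))
    (fun r s => (RingQuot.mkAlgHom_rel k (GWARel.coeff_mul r s)).trans (map_mul _ _ _))

/-- The generator `x`. -/
noncomputable def x : GWA σ a := RingQuot.mkAlgHom k (GWARel σ a) (FreeAlgebra.ι k GWAGen.x)

/-- The generator `y`. -/
noncomputable def y : GWA σ a := RingQuot.mkAlgHom k (GWARel σ a) (FreeAlgebra.ι k GWAGen.y)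

theorem x_mul_coeff (r : R) : x σ a * coeff σ a r = coeff σ a (σ r) * x σ a :=
  ((map_mul _ _ _).symm.trans (RingQuot.mkAlgHom_rel k (GWARel.x_coeff r))).trans (map_mul _ _ _)

theorem y_mul_coeff (r : R) : y σ a * coeff σ a r = coeff σ a (σ.symm r) * y σ a :=
  ((map_mul _ _ _).symm.trans (RingQuot.mkAlgHom_rel k (GWARel.y_coeff r))).trans (map_mul _ _ _)

theorem x_mul_y : x σ a * y σ a = coeff σ a (σ a) :=
  (map_mul _ _ _).symm.trans (RingQuot.mkAlgHom_rel k GWARel.x_y)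

theorem y_mul_x : y σ a * x σ a = coeff σ a a :=
  (map_mul _ _ _).symm.trans (RingQuot.mkAlgHom_rel k GWARel.y_x)

variable {σ a}

@[elab_as_elim]
theorem induction {motive : GWA σ a → Prop} (coeff : ∀ r, motive (coeff σ a r))
    (x : motive (x σ a)) (y : motive (y σ a)) (mul : ∀ b c, motive b → motive c → motive (b * c))
    (add : ∀ b c, motive b → motive c → motive (b + c)) (b : GWA σ a) : motive b := by
  obtain ⟨b, rfl⟩ := RingQuot.mkAlgHom_surjective k (GWARel σ a) b
  induction b using FreeAlgebra.induction with
  | grade0 c =>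
    rw [AlgHom.commutes, ← AlgHom.commutes (GWA.coeff σ a)]
    exact coeff _
  | grade1 g =>
    cases g with
    | coeff r => exact coeff r
    | x => exact x
    | y => exact y
  | mul b c hb hc => rw [map_mul]; exact mul _ _ hb hc
  | add b c hb hc => rw [map_add]; exact add _ _ hb hc

variable (σ a)

/-- The action of the generators on sequences that comes from the left regular representation of
the skew Laurent polynomial ring. -/
def genAction : GWAGen R → Module.End k (ℤ → R)
  | .coeff r =>
    { toFun := fun f j => r * f j
      map_add' := fun f g => by ext; simp [mul_add]
      map_smul' := fun c f => by ext; simp }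
  | .x =>
    { toFun := fun f j => σ (f (j - 1))
      map_add' := fun f g => by ext; simp
      map_smul' := fun c f => by ext; simp }
  | .y =>
    { toFun := fun f j => a * σ.symm (f (j + 1))
      map_add' := fun f g => by ext; simp [mul_add]
      map_smul' := fun c f => by ext; simp }

/-- The representation of `R(σ, a)` on sequences, with `y` acting as `a x⁻¹`. -/
noncomputable def toEnd : GWA σ a →ₐ[k] Module.End k (ℤ → R) :=
  RingQuot.liftAlgHom k ⟨FreeAlgebra.lift k (genAction σ a), fun _ _ h => by
    cases h <;> ext f j <;> simp [genAction, add_mul, mul_assoc, Algebra.smul_def]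
    ring⟩

@[simp]
theorem toEnd_coeff (r : R) (f : ℤ → R) (j : ℤ) : toEnd σ a (coeff σ a r) f j = r * f j := by
  change toEnd σ a (RingQuot.mkAlgHom k (GWARel σ a) _) f j = _
  simp [toEnd, genAction]

@[simp]
theorem toEnd_x (f : ℤ → R) (j : ℤ) : toEnd σ a (x σ a) f j = σ (f (j - 1)) := by
  simp [toEnd, genAction, x]

@[simp]
theorem toEnd_y (f : ℤ → R) (j : ℤ) : toEnd σ a (y σ a) f j = a * σ.symm (f (j + 1)) := by
  simp [toEnd, genAction, y]

/-- The basis of `R(σ, a)` over `R`: powers of `x` in nonnegative degrees, of `y` in negative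
ones. -/
noncomputable def monomial : ℤ → GWA σ a
  | .ofNat n => x σ a ^ n
  | .negSucc n => y σ a ^ (n + 1)

theorem monomial_natCast (n : ℕ) : monomial σ a n = x σ a ^ n := rfl

theorem monomial_neg_natCast (n : ℕ) : monomial σ a (-n) = y σ a ^ n := by
  cases n with
  | zero => simpa using monomial_natCast σ a 0
  | succ n => rfl

theorem monomial_zero : monomial σ a 0 = 1 := by
  simpa using monomial_natCast σ a 0

theorem exists_x_mul_monomial (i : ℤ) :
    ∃ r, x σ a * monomial σ a i = coeff σ a r * monomial σ a (i + 1) := by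
  obtain ⟨n, rfl | rfl⟩ := i.eq_nat_or_neg
  · exact ⟨1, by rw [map_one, one_mul, monomial_natCast, ← pow_succ', ← monomial_natCast]; rfl⟩
  · cases n with
    | zero => exact ⟨1, by simpa [monomial_zero] using (monomial_natCast σ a 1).symm⟩
    | succ n =>
      -- `x y ^ (n + 1) = (x y) y ^ n`.
      refine ⟨σ a, ?_⟩
      rw [show -((n + 1 : ℕ) : ℤ) + 1 = -(n : ℤ) by push_cast; ring, monomial_neg_natCast,
        monomial_neg_natCast, pow_succ', ← mul_assoc, x_mul_y]

theorem exists_y_mul_monomial (i : ℤ) :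
    ∃ r, y σ a * monomial σ a i = coeff σ a r * monomial σ a (i - 1) := by
  obtain ⟨n, rfl | rfl⟩ := i.eq_nat_or_neg
  · cases n with
    | zero => exact ⟨1, by simpa [monomial_zero] using (monomial_neg_natCast σ a 1).symm⟩
    | succ n =>
      refine ⟨a, ?_⟩
      rw [show ((n + 1 : ℕ) : ℤ) - 1 = (n : ℤ) by push_cast; ring, monomial_natCast,
        monomial_natCast, pow_succ', ← mul_assoc, y_mul_x]
  · refine ⟨1, ?_⟩
    rw [show -(n : ℤ) - 1 = -((n + 1 : ℕ) : ℤ) by push_cast; ring, monomial_neg_natCast,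
      monomial_neg_natCast, map_one, one_mul, pow_succ']

/-- The linear combination of monomials with given coefficients. -/
noncomputable def ofCoords : (ℤ →₀ R) →+ GWA σ a :=
  Finsupp.liftAddHom fun i =>
    (AddMonoidHom.mulRight (monomial σ a i)).comp (coeff σ a : R →+ GWA σ a)

theorem ofCoords_single (i : ℤ) (r : R) :
    ofCoords σ a (.single i r) = coeff σ a r * monomial σ a i := by
  simp [ofCoords]

theorem ofCoords_surjective : Function.Surjective (ofCoords σ a) := by
  -- The range is a left ideal, and it contains `1`.
  have hmul : ∀ b : GWA σ a, ∀ c ∈ (ofCoords σ a).range, b * c ∈ (ofCoords σ a).range := by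
    intro b
    induction b using GWA.induction with
    | mul b c hb hc => exact fun d hd => by rw [mul_assoc]; exact hb _ (hc _ hd)
    | add b c hb hc => exact fun d hd => by rw [add_mul]; exact add_mem (hb _ hd) (hc _ hd)
    | coeff r =>
      rintro _ ⟨g, rfl⟩
      induction g using Finsupp.induction_linear with
      | zero => simp
      | add f g hf hg => rw [map_add, mul_add]; exact add_mem hf hg
      | single i s => exact ⟨.single i (r * s), by
        rw [ofCoords_single, ofCoords_single, map_mul, mul_assoc]⟩
    | x =>
      rintro _ ⟨g, rfl⟩
      induction g using Finsupp.induction_linear with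
      | zero => simp
      | add f g hf hg => rw [map_add, mul_add]; exact add_mem hf hg
      | single i s =>
        obtain ⟨r, hr⟩ := exists_x_mul_monomial σ a i
        refine ⟨.single (i + 1) (σ s * r), ?_⟩
        rw [ofCoords_single, ofCoords_single, ← mul_assoc, x_mul_coeff, mul_assoc, hr, map_mul,
          mul_assoc]
    | y =>
      rintro _ ⟨g, rfl⟩
      induction g using Finsupp.induction_linear with
      | zero => simp
      | add f g hf hg => rw [map_add, mul_add]; exact add_mem hf hg
      | single i s =>
        obtain ⟨r, hr⟩ := exists_y_mul_monomial σ a i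
        refine ⟨.single (i - 1) (σ.symm s * r), ?_⟩
        rw [ofCoords_single, ofCoords_single, ← mul_assoc, y_mul_coeff, mul_assoc, hr, map_mul,
          mul_assoc]
  intro b
  simpa using hmul b 1 ⟨.single 0 1, by simp [ofCoords_single, monomial_zero]⟩

/-- The coefficient in degree `j` of an element of `R(σ, a)`, viewed as a skew Laurent polynomial
with `y = a x⁻¹`. -/
noncomputable def coord (b : GWA σ a) (j : ℤ) : R := toEnd σ a b (Pi.single 0 1) j

@[simp]
theorem coord_zero (j : ℤ) : coord σ a 0 j = 0 := by simp [coord]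

theorem coord_add (b c : GWA σ a) (j : ℤ) :
    coord σ a (b + c) j = coord σ a b j + coord σ a c j := by
  simp [coord]

theorem coord_mul (b c : GWA σ a) (j : ℤ) :
    coord σ a (b * c) j = toEnd σ a b (coord σ a c) j := by
  rw [coord, map_mul]; rfl

theorem coord_coeff (r : R) (j : ℤ) : coord σ a (coeff σ a r) j = if j = 0 then r else 0 := by
  simp [coord, Pi.single_apply]

theorem coord_one (j : ℤ) : coord σ a 1 j = if j = 0 then 1 else 0 := by
  rw [← map_one (coeff σ a), coord_coeff]

theorem coeff_injective : Function.Injective (coeff σ a) := fun r s h => by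
  simpa [coord_coeff] using congrArg (fun b => coord σ a b 0) h

variable {a} in
/-- `b` has leading coefficient `r` in degree `n`. -/
def HasTop (b : GWA σ a) (n : ℤ) (r : R) : Prop :=
  r ≠ 0 ∧ coord σ a b n = r ∧ ∀ j, n < j → coord σ a b j = 0

variable {σ a}

theorem HasTop.unique {b : GWA σ a} {n m : ℤ} {r s : R} (h : HasTop σ b n r)
    (h' : HasTop σ b m s) : r = s := by
  obtain ⟨hr, rfl, hn⟩ := h
  obtain ⟨hs, rfl, hm⟩ := h'
  rcases lt_trichotomy n m with hlt | rfl | hlt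
  · exact absurd (hn _ hlt) hs
  · rfl
  · exact absurd (hm _ hlt) hr

theorem HasTop.ne_zero {b : GWA σ a} {n : ℤ} {r : R} (h : HasTop σ b n r) : b ≠ 0 := by
  rintro rfl
  exact h.1 (by rw [← h.2.1, coord_zero])

theorem hasTop_coeff {r : R} (hr : r ≠ 0) : HasTop σ (coeff σ a r) 0 r :=
  ⟨hr, by simp [coord_coeff], fun j hj => by simp [coord_coeff, hj.ne']⟩

end Generators

/-! ### Coordinates and leading coefficients over a domain -/

section Domain

variable {k : Type*} [CommRing k] {R : Type*} [CommRing R] [IsDomain R] [Algebra k R]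
  (σ : R ≃ₐ[k] R) {a : R}

/-- With `y = a x⁻¹`, a power of `y` is a power of `x⁻¹` times a product of twists of `a`, nonzero
in a domain. So each monomial lives in a single degree, and the representation separates
coordinates. -/
theorem exists_toEnd_monomial (ha : a ≠ 0) (i : ℤ) :
    ∃ c ≠ 0, ∀ f j, toEnd σ a (monomial σ a i) f j = c * (σ ^ i) (f (j - i)) := by
  obtain ⟨n, rfl | rfl⟩ := i.eq_nat_or_neg
  · refine ⟨1, one_ne_zero, ?_⟩
    rw [monomial_natCast]
    induction n with
    | zero => simp
    | succ n ih =>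
      intro f j
      rw [pow_succ', map_mul, Module.End.mul_apply, toEnd_x, ih, one_mul, one_mul, Nat.cast_succ,
        add_comm, zpow_one_add, AlgEquiv.mul_apply, sub_sub]
  · rw [monomial_neg_natCast]
    induction n with
    | zero => exact ⟨1, one_ne_zero, by simp⟩
    | succ n ih =>
      obtain ⟨c, hc, h⟩ := ih
      refine ⟨a * σ.symm c, mul_ne_zero ha (by simpa using hc), fun f j => ?_⟩
      rw [pow_succ', map_mul, Module.End.mul_apply, toEnd_y, h, map_mul, mul_assoc,
        show -((n + 1 : ℕ) : ℤ) = -1 + -(n : ℤ) by push_cast; ring, zpow_add, AlgEquiv.mul_apply,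
        zpow_neg_one, show j + 1 - -(n : ℤ) = j - (-1 + -(n : ℤ)) by ring]
      rfl

theorem coord_monomial_self_ne_zero (ha : a ≠ 0) (i : ℤ) : coord σ a (monomial σ a i) i ≠ 0 := by
  obtain ⟨c, hc, h⟩ := exists_toEnd_monomial σ ha i
  simpa [coord, h] using hc

theorem toEnd_monomial (ha : a ≠ 0) (i : ℤ) (f : ℤ → R) (j : ℤ) :
    toEnd σ a (monomial σ a i) f j = coord σ a (monomial σ a i) i * (σ ^ i) (f (j - i)) := by
  obtain ⟨c, -, h⟩ := exists_toEnd_monomial σ ha i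
  simp [coord, h]

theorem toEnd_ofCoords (ha : a ≠ 0) (g : ℤ →₀ R) (f : ℤ → R) (j : ℤ) :
    toEnd σ a (ofCoords σ a g) f j =
      ∑ i ∈ g.support, g i * coord σ a (monomial σ a i) i * (σ ^ i) (f (j - i)) := by
  simp [ofCoords, Finsupp.sum, toEnd_monomial σ ha, mul_assoc, LinearMap.sum_apply]

theorem coord_ofCoords (ha : a ≠ 0) (g : ℤ →₀ R) (j : ℤ) :
    coord σ a (ofCoords σ a g) j = g j * coord σ a (monomial σ a j) j := by
  rw [coord, toEnd_ofCoords σ ha, Finset.sum_eq_single j]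
  · simp
  · intro i _ hij
    rw [Pi.single_eq_of_ne (sub_ne_zero.mpr (Ne.symm hij)), map_zero, mul_zero]
  · intro h
    simp [Finsupp.notMem_support_iff.mp h]

theorem coord_ofCoords_eq_zero_iff (ha : a ≠ 0) (g : ℤ →₀ R) (j : ℤ) :
    coord σ a (ofCoords σ a g) j = 0 ↔ g j = 0 := by
  rw [coord_ofCoords σ ha, mul_eq_zero, or_iff_left (coord_monomial_self_ne_zero σ ha j)]

theorem eq_zero_of_coord_eq_zero (ha : a ≠ 0) (b : GWA σ a) (hb : ∀ j, coord σ a b j = 0) :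
    b = 0 := by
  obtain ⟨g, rfl⟩ := ofCoords_surjective σ a b
  have : g = 0 := Finsupp.ext fun j => (coord_ofCoords_eq_zero_iff σ ha g j).mp (hb j)
  rw [this, map_zero]

theorem finite_support_coord (ha : a ≠ 0) (b : GWA σ a) :
    (Function.support (coord σ a b)).Finite := by
  obtain ⟨g, rfl⟩ := ofCoords_surjective σ a b
  exact g.support.finite_toSet.subset fun j hj =>
    Finsupp.mem_support_iff.mpr fun h => hj ((coord_ofCoords_eq_zero_iff σ ha g j).mpr h)

/-- Coefficients of a product are given by skew convolution. -/
theorem coord_mul_eq_sum (ha : a ≠ 0) (b c : GWA σ a) {s : Finset ℤ}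
    (hs : ∀ i ∉ s, coord σ a b i = 0) (j : ℤ) :
    coord σ a (b * c) j = ∑ i ∈ s, coord σ a b i * (σ ^ i) (coord σ a c (j - i)) := by
  obtain ⟨g, rfl⟩ := ofCoords_surjective σ a b
  rw [coord_mul, toEnd_ofCoords σ ha]
  simp_rw [coord_ofCoords σ ha]
  apply Finset.sum_subset
  · intro i hi
    by_contra h
    exact Finsupp.mem_support_iff.mp hi ((coord_ofCoords_eq_zero_iff σ ha g i).mp (hs i h))
  · intro i _ hi
    simp [Finsupp.notMem_support_iff.mp hi]

variable {σ}

theorem exists_hasTop (ha : a ≠ 0) {b : GWA σ a} (hb : b ≠ 0) : ∃ n r, HasTop σ b n r := by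
  let s := (finite_support_coord σ ha b).toFinset
  have hs : s.Nonempty := by
    by_contra hs
    refine hb (eq_zero_of_coord_eq_zero σ ha b fun j => ?_)
    by_contra hj
    exact hs ⟨j, by simpa [s] using hj⟩
  refine ⟨s.max' hs, _, by simpa [s] using s.max'_mem hs, rfl, fun j hj => ?_⟩
  by_contra h
  exact absurd (s.le_max' j (by simpa [s] using h)) (not_le.mpr hj)

theorem HasTop.mul (ha : a ≠ 0) {b c : GWA σ a} {n m : ℤ} {r s : R} (hb : HasTop σ b n r)
    (hc : HasTop σ c m s) : HasTop σ (b * c) (n + m) (r * (σ ^ n) s) := by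
  let S := (finite_support_coord σ ha b).toFinset
  have hS : ∀ i ∉ S, coord σ a b i = 0 := fun i hi => by simpa [S] using hi
  refine ⟨mul_ne_zero hb.1 (by simpa using hc.1), ?_, fun j hj => ?_⟩
  · rw [coord_mul_eq_sum σ ha b c hS, Finset.sum_eq_single n, hb.2.1, add_sub_cancel_left, hc.2.1]
    · intro i _ hi
      rcases hi.lt_or_gt with hi | hi
      · rw [hc.2.2 _ (by linarith), map_zero, mul_zero]
      · rw [hb.2.2 _ hi, zero_mul]
    · intro hn
      rw [hS n hn, zero_mul]
  · rw [coord_mul_eq_sum σ ha b c hS]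
    refine Finset.sum_eq_zero fun i _ => ?_
    rcases le_or_gt i n with hi | hi
    · rw [hc.2.2 _ (by linarith), map_zero, mul_zero]
    · rw [hb.2.2 _ hi, zero_mul]

theorem noZeroDivisors (ha : a ≠ 0) : NoZeroDivisors (GWA σ a) where
  eq_zero_or_eq_zero_of_mul_eq_zero {b c} h := by
    by_contra! hbc
    obtain ⟨n, r, hb⟩ := exists_hasTop ha hbc.1
    obtain ⟨m, s, hc⟩ := exists_hasTop ha hbc.2
    exact (hb.mul ha hc).ne_zero h

instance nontrivial : Nontrivial (GWA σ a) :=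
  (coeff_injective σ a).nontrivial

open Classical in
/-- An invariant multiplicative function on the coefficient ring extends to `R(σ, a)` through
leading coefficients. -/
theorem exists_multiplicative_extension (ha : a ≠ 0) {Γ : Type*} [CommGroupWithZero Γ]
    (l : R →*₀ Γ) (hl : ∀ r, l r = 0 → r = 0) (hσ : ∀ r, l (σ r) = l r) :
    ∃ L : GWA σ a →*₀ Γ, (∀ b, L b = 0 → b = 0) ∧ ∀ r, L (coeff σ a r) = l r := by
  have hσz : ∀ (n : ℤ) (r : R), l ((σ ^ n) r) = l r := fun n => by
    induction n with
    | zero => simp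
    | succ n ih => intro r; rw [add_comm, zpow_one_add, AlgEquiv.mul_apply, hσ, ih]
    | pred n ih =>
      intro r
      have h : σ ^ (-(n : ℤ)) = σ * σ ^ (-(n : ℤ) - 1) := by
        rw [← zpow_one_add, add_sub_cancel]
      rw [← ih r, h, AlgEquiv.mul_apply, hσ]
  -- The choice is harmless by `HasTop.unique`; the twist in `HasTop.mul` is invisible to `l` by
  -- `hσz`.
  let L : GWA σ a → Γ := fun b => if h : b = 0 then 0 else l (exists_hasTop ha h).choose_spec.choose
  have hL : ∀ {b n r}, HasTop σ b n r → L b = l r := fun {b n r} h => by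
    have hb := h.ne_zero
    simp only [L, dif_neg hb]
    rw [(exists_hasTop ha hb).choose_spec.choose_spec.unique h]
  have hL0 : L 0 = 0 := dif_pos rfl
  have hLc : ∀ r, L (coeff σ a r) = l r := fun r => by
    by_cases hr : r = 0
    · rw [hr, map_zero, map_zero, hL0]
    · exact hL (hasTop_coeff hr)
  refine ⟨⟨⟨L, hL0⟩, ?_, fun b c => ?_⟩, fun b hb => ?_, hLc⟩
  · simpa using hLc 1
  · change L (b * c) = L b * L c
    by_cases hb : b = 0
    · rw [hb, zero_mul, hL0, zero_mul]
    by_cases hc : c = 0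
    · rw [hc, mul_zero, hL0, mul_zero]
    obtain ⟨n, r, hb⟩ := exists_hasTop ha hb
    obtain ⟨m, s, hc⟩ := exists_hasTop ha hc
    rw [hL (hb.mul ha hc), hL hb, hL hc, map_mul, hσz]
  · by_contra h
    obtain ⟨n, r, h⟩ := exists_hasTop ha h
    exact h.1 (hl r ((hL h).symm.trans hb))

end Domain

end GWA

/-! ### The commutative case and the left Ore condition -/

namespace GWA

section Commutative

variable {k : Type*} [CommRing k] {R : Type*} [CommRing R] [Algebra k R] {a : R}

theorem mul_comm_of_eq_refl (b c : GWA (AlgEquiv.refl : R ≃ₐ[k] R) a) : b * c = c * b := by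
  suffices hcen : ∀ b : GWA (AlgEquiv.refl : R ≃ₐ[k] R) a,
      b ∈ Subalgebra.center k (GWA (AlgEquiv.refl : R ≃ₐ[k] R) a) from
    (Subalgebra.mem_center_iff.mp (hcen c) b)
  have hcoeff : ∀ r (b : GWA (AlgEquiv.refl : R ≃ₐ[k] R) a),
      b * coeff _ a r = coeff _ a r * b := fun r b => by
    induction b using GWA.induction with
    | coeff s => rw [← map_mul, ← map_mul, mul_comm]
    | x => exact x_mul_coeff _ _ _
    | y => exact y_mul_coeff _ _ _
    | mul b c hb hc => rw [mul_assoc, hc, ← mul_assoc, hb, mul_assoc]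
    | add b c hb hc => rw [add_mul, mul_add, hb, hc]
  have hxy : x (AlgEquiv.refl : R ≃ₐ[k] R) a * y _ a = y _ a * x _ a := by
    rw [x_mul_y, y_mul_x]; rfl
  intro b
  induction b using GWA.induction with
  | coeff r => exact Subalgebra.mem_center_iff.mpr (hcoeff r)
  | x =>
    refine Subalgebra.mem_center_iff.mpr fun b => ?_
    induction b using GWA.induction with
    | coeff s => exact (hcoeff _ _).symm
    | x => rfl
    | y => exact hxy.symm
    | mul b c hb hc => rw [mul_assoc, hc, ← mul_assoc, hb, mul_assoc]
    | add b c hb hc => rw [add_mul, mul_add, hb, hc]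
  | y =>
    refine Subalgebra.mem_center_iff.mpr fun b => ?_
    induction b using GWA.induction with
    | coeff s => exact (hcoeff _ _).symm
    | x => exact hxy
    | y => rfl
    | mul b c hb hc => rw [mul_assoc, hc, ← mul_assoc, hb, mul_assoc]
    | add b c hb hc => rw [add_mul, mul_add, hb, hc]
  | mul b c hb hc => exact mul_mem hb hc
  | add b c hb hc => exact add_mem hb hc

end Commutative

section Ore

variable {k : Type*} [CommRing k] {R : Type*} [CommRing R] [IsDomain R] [Algebra k R]
  {σ : R ≃ₐ[k] R} {a : R}

theorem exists_coord_bound (ha : a ≠ 0) (b : GWA σ a) :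
    ∃ N : ℕ, ∀ j : ℤ, (N : ℤ) < |j| → coord σ a b j = 0 := by
  let s := (finite_support_coord σ ha b).toFinset
  refine ⟨s.sup Int.natAbs, fun j hj => ?_⟩
  by_contra h
  have : j.natAbs ≤ s.sup Int.natAbs := Finset.le_sup (by simpa [s] using h)
  rw [Int.abs_eq_natAbs] at hj
  omega

theorem coord_sum_mul (ha : a ≠ 0) {ι : Type*} [Fintype ι] (e : ι → ℤ) (w : ι → R) (d : GWA σ a)
    (j : ℤ) : coord σ a ((∑ i, coeff σ a (w i) * monomial σ a (e i)) * d) j =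
      ∑ i, w i * (coord σ a (monomial σ a (e i)) (e i) * (σ ^ e i) (coord σ a d (j - e i))) := by
  simp [coord_mul, LinearMap.sum_apply, toEnd_monomial σ ha]

theorem eq_zero_of_sum_eq_zero (ha : a ≠ 0) {ι : Type*} [Fintype ι] {e : ι → ℤ}
    (he : Function.Injective e) {w : ι → R} (h : ∑ i, coeff σ a (w i) * monomial σ a (e i) = 0) :
    w = 0 := by
  funext i
  have h1 := coord_sum_mul (σ := σ) ha e w 1 (e i)
  rw [h, zero_mul, coord_zero, Finset.sum_eq_single i] at h1
  · rw [coord_one, if_pos (sub_self _), map_one, mul_one, eq_comm] at h1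
    exact (mul_eq_zero.mp h1).resolve_right (coord_monomial_self_ne_zero σ ha _)
  · intro j _ hj
    rw [coord_one,
      if_neg (sub_ne_zero.mpr fun h => hj (he h).symm), map_zero, mul_zero, mul_zero]
  · simp

/-- `R(σ, a)` over a domain satisfies the left Ore condition: the number of coefficients of
`s b` and `t c` grows more slowly than that of `(s, t)`. -/
theorem exists_mul_eq_mul (ha : a ≠ 0) {b c : GWA σ a} (hc : c ≠ 0) :
    ∃ s t : GWA σ a, s ≠ 0 ∧ s * b = t * c := by
  obtain ⟨N₁, hN₁⟩ := exists_coord_bound ha b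
  obtain ⟨N₂, hN₂⟩ := exists_coord_bound ha c
  let N := max N₁ N₂
  let J := Finset.Icc (-N : ℤ) N
  let J' := Finset.Icc (-(N + N : ℕ) : ℤ) (N + N : ℕ)
  let row (d : GWA σ a) (i j : ℤ) : R :=
    coord σ a (monomial σ a i) i * (σ ^ i) (coord σ a d (j - i))
  -- Rows are the coordinates of monomials times `b` or `c`. There are `2(2N + 1) = 4N + 2` rows but
  -- only `4N + 1` columns, so the rows satisfy a nontrivial linear relation over `R`.
  let M : Matrix (J ⊕ J) J' R := fun i j =>
    Sum.elim (fun i : J => row b i j) (fun i : J => row c i j) i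
  have hM : ¬ Function.Injective M.vecMulLinear := fun h => by
    have := card_le_of_injective R _ h
    simp [J, J'] at this
    omega
  obtain ⟨w, hw, hw0⟩ : ∃ w, Matrix.vecMul w M = 0 ∧ w ≠ 0 := by
    by_contra! h
    exact hM ((injective_iff_map_eq_zero M.vecMulLinear).mpr h)
  let e : J → ℤ := fun i => i
  have he : Function.Injective e := Subtype.val_injective
  let s := ∑ i, coeff σ a (w (.inl i)) * monomial σ a (e i)
  let t := ∑ i, coeff σ a (w (.inr i)) * monomial σ a (e i)
  have hst : s * b + t * c = 0 := by
    refine eq_zero_of_coord_eq_zero σ ha _ fun j => ?_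
    rw [coord_add, coord_sum_mul ha, coord_sum_mul ha]
    by_cases hj : j ∈ J'
    · have := congrFun hw ⟨j, hj⟩
      simpa [Matrix.vecMul, dotProduct, M, row] using this
    · have hfar : ∀ i : J, (N : ℤ) < |j - e i| := fun i => by
        have h1 := Finset.mem_Icc.mp i.2
        rw [Finset.mem_Icc] at hj
        change (N : ℤ) < |j - (i : ℤ)|
        rw [lt_abs]
        push_cast at hj
        omega
      have hb : ∀ i : J, coord σ a b (j - e i) = 0 := fun i =>
        hN₁ _ (lt_of_le_of_lt (by exact_mod_cast le_max_left N₁ N₂) (hfar i))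
      have hc : ∀ i : J, coord σ a c (j - e i) = 0 := fun i =>
        hN₂ _ (lt_of_le_of_lt (by exact_mod_cast le_max_right N₁ N₂) (hfar i))
      simp [hb, hc]
  refine ⟨s, -t, fun hs => hw0 ?_, 
    (eq_neg_of_add_eq_zero_left hst).trans (neg_mul t c).symm⟩
  -- If `s = 0` then `t * c = 0`, so `t = 0` and the whole relation `w` is trivial.
  have := noZeroDivisors (σ := σ) ha
  rw [hs, zero_mul, zero_add, mul_eq_zero, or_iff_left hc] at hst
  have hl := eq_zero_of_sum_eq_zero ha he hs
  have hr := eq_zero_of_sum_eq_zero ha he hst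
  funext i
  cases i with
  | inl i => exact congrFun hl i
  | inr i => exact congrFun hr i

end Ore

/-! ### Eigenvalues of the automorphism under Morita equivalence -/

section Morita

universe u

variable {k : Type u} [Field k] {R : Type u} [CommRing R] [IsDomain R] [Algebra k R]
  {σ : R ≃ₐ[k] R} {a : R} {S : Type u} [CommRing S] [IsDomain S] [Algebra k S]
  {τ : S ≃ₐ[k] S} {b : S}

theorem x_ne_zero : x σ a ≠ 0 := fun h => by
  have := congrArg (fun c => coord σ a c 1) h
  simp [coord] at this

/-- If `R(σ, a)` and `S(τ, b)` are Morita equivalent, then every `τ`-invariant multiplicative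
function on `S` maps the eigenvalues of `σ` to one. -/
theorem map_eigenvalue_eq_one (h : IsMoritaEquivalent k (GWA σ a) (GWA τ b)) (ha : a ≠ 0)
    (hb : b ≠ 0) {Γ : Type*} [CommGroupWithZero Γ] (l : S →*₀ Γ) (hl : ∀ r, l r = 0 → r = 0)
    (hτ : ∀ r, l (τ r) = l r) {c : k} {r : R} (hr : r ≠ 0) (hc : σ r = algebraMap k R c * r) :
    l (algebraMap k S c) = 1 := by
  have := noZeroDivisors (σ := σ) ha
  have := noZeroDivisors (σ := τ) hb
  obtain ⟨L, hL, hLl⟩ := exists_multiplicative_extension hb l hl hτ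
  rw [← hLl, AlgHom.commutes]
  refine h.map_algebraMap_eq_one L hL (fun s t _ ht => exists_mul_eq_mul hb ht)
    (x_ne_zero (σ := σ) (a := a)) ((map_ne_zero_iff _ (coeff_injective σ a)).mpr hr) ?_
  rw [x_mul_coeff, hc, map_mul, AlgHom.commutes, mul_assoc]

end Morita

end GWA

/-! ### Invariant leading coefficients on polynomials and Laurent polynomials -/

section LeadingCoefficients

/-- Every subgroup of `kˣ` is the kernel of a multiplicative function on `k`. -/
theorem exists_monoidWithZeroHom_ker.{u} {k : Type u} [Field k] (H : Subgroup kˣ) :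
    ∃ (Γ : Type u) (_ : CommGroupWithZero Γ) (π : k →*₀ Γ), (∀ c, π c = 0 → c = 0) ∧
      ∀ u : kˣ, π u = 1 ↔ u ∈ H := by
  classical
  let π : k →*₀ WithZero (kˣ ⧸ H) := (WithZero.map' (QuotientGroup.mk' H)).comp
    (WithZero.withZeroUnitsEquiv (G := k)).symm.toMonoidWithZeroHom
  have hπ : ∀ u : kˣ, π u = ((u : kˣ ⧸ H) : WithZero (kˣ ⧸ H)) := fun u => by simp [π]
  refine ⟨WithZero (kˣ ⧸ H), inferInstance, π, fun c h => ?_, fun u => ?_⟩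
  · by_contra hc
    rw [← Units.val_mk0 hc] at h
    exact WithZero.coe_ne_zero ((hπ _).symm.trans h)
  · rw [← QuotientGroup.eq_one_iff]
    exact (hπ u).congr_left.trans WithZero.coe_inj

variable {k : Type*} [Field k] {Γ : Type*} [CommGroupWithZero Γ] (π : k →*₀ Γ)

/-- The leading coefficient of a polynomial, under a multiplicative function on the field. -/
noncomputable def mapLeadingCoeff : k[X] →*₀ Γ where
  toFun p := π p.leadingCoeff
  map_zero' := by simp
  map_one' := by simp
  map_mul' p q := by simp

theorem mapLeadingCoeff_apply (p : k[X]) : mapLeadingCoeff π p = π p.leadingCoeff := rfl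

variable {π} in
theorem eq_zero_of_mapLeadingCoeff_eq_zero (hπ : ∀ c, π c = 0 → c = 0) (p : k[X])
    (h : mapLeadingCoeff π p = 0) : p = 0 :=
  Polynomial.leadingCoeff_eq_zero.mp (hπ _ h)

theorem mapLeadingCoeff_algebraMap (c : k) :
    mapLeadingCoeff π (algebraMap k k[X] c) = π c := by
  simp [mapLeadingCoeff_apply]

theorem sigmaCl_apply (p : k[X]) : sigmaCl k p = p.comp (Polynomial.X - 1) := rfl

theorem mapLeadingCoeff_sigmaCl (p : k[X]) :
    mapLeadingCoeff π (sigmaCl k p) = mapLeadingCoeff π p := by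
  have h1 : (Polynomial.X - 1 : k[X]) = Polynomial.X - Polynomial.C 1 := by simp
  rw [sigmaCl_apply, mapLeadingCoeff_apply, h1,
    Polynomial.leadingCoeff_comp (by rw [Polynomial.natDegree_X_sub_C]; exact one_ne_zero),
    Polynomial.leadingCoeff_X_sub_C, one_pow, mul_one, mapLeadingCoeff_apply]

theorem sigmaQ_apply (q : kˣ) (p : k[X]) :
    sigmaQ q p = p.comp (Polynomial.C (q : k) * Polynomial.X) := rfl

/-- Scaling `h` by `q` multiplies the leading coefficient by a power of `q`, which `π` sends to one.
-/
theorem mapLeadingCoeff_sigmaQ {q : kˣ} (hq : π q = 1) (p : k[X]) :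
    mapLeadingCoeff π (sigmaQ q p) = mapLeadingCoeff π p := by
  rw [sigmaQ_apply, mapLeadingCoeff_apply, Polynomial.leadingCoeff_comp
    (by rw [Polynomial.natDegree_C_mul_X _ q.ne_zero]; exact one_ne_zero),
    Polynomial.leadingCoeff_mul, Polynomial.leadingCoeff_C, Polynomial.leadingCoeff_X, mul_one,
    map_mul, map_pow, hq, one_pow, mul_one, mapLeadingCoeff_apply]

theorem sigmaQ_X (q : kˣ) :
    sigmaQ q Polynomial.X = algebraMap k k[X] (q : k) * Polynomial.X := by
  simp [sigmaQ_apply]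

theorem sigmaQ_one : sigmaQ (1 : kˣ) = AlgEquiv.refl := by
  ext p
  simp [sigmaQ_apply]

theorem sigmaQLaurent_T (q : kˣ) (n : ℤ) :
    sigmaQLaurent q (LaurentPolynomial.T n) = ((q ^ n : kˣ) : k) • LaurentPolynomial.T n :=
  laurentScale_T q n

theorem sigmaQLaurent_symm (q : kˣ) : (sigmaQLaurent q).symm = sigmaQLaurent q⁻¹ := by
  ext f
  simp [sigmaQLaurent]

theorem sigmaQLaurent_toLaurent (q : kˣ) (p : k[X]) :
    sigmaQLaurent q (Polynomial.toLaurent p) = Polynomial.toLaurent (sigmaQ q p) := by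
  have : (sigmaQLaurent q).toAlgHom.comp Polynomial.toLaurentAlg =
      Polynomial.toLaurentAlg.comp (sigmaQ q).toAlgHom := by
    apply Polynomial.algHom_ext
    simp [sigmaQLaurent_T, sigmaQ_X, LaurentPolynomial.smul_eq_C_mul]
  exact DFunLike.congr_fun this p

theorem sigmaQLaurent_one : sigmaQLaurent (1 : kˣ) = AlgEquiv.refl := by
  ext f n
  obtain ⟨n, p, hp⟩ := f.exists_T_pow
  have : sigmaQLaurent (1 : kˣ) (f * LaurentPolynomial.T n) = f * LaurentPolynomial.T n := by
    rw [← hp, sigmaQLaurent_toLaurent, sigmaQ_one]; rfl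
  rw [map_mul, sigmaQLaurent_T, one_zpow, Units.val_one, one_smul] at this
  rw [(LaurentPolynomial.isUnit_T (n : ℤ)).mul_right_cancel this]
  rfl

/-- The leading coefficient of a Laurent polynomial, under a multiplicative function on the
field. -/
theorem exists_laurent_mapLeadingCoeff (hπ : ∀ c, π c = 0 → c = 0) :
    ∃ l : k[T;T⁻¹] →*₀ Γ, (∀ f, l f = 0 → f = 0) ∧ (∀ c : k, l (algebraMap k _ c) = π c) ∧
      ∀ q : kˣ, π q = 1 → ∀ f, l (sigmaQLaurent q f) = l f := by
  -- Clear denominators by a power of `h`; `hl` shows that the choice of power does not matter.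
  let l : k[T;T⁻¹] → Γ := fun f =>
    mapLeadingCoeff π f.exists_T_pow.choose_spec.choose
  have hl : ∀ {f : k[T;T⁻¹]} {n : ℕ} {p : k[X]},
      Polynomial.toLaurent p = f * LaurentPolynomial.T n → l f = mapLeadingCoeff π p := by
    intro f n p hp
    have hp' := f.exists_T_pow.choose_spec.choose_spec
    simp only [l]
    set m := f.exists_T_pow.choose
    set p' := f.exists_T_pow.choose_spec.choose
    have : p' * Polynomial.X ^ n = p * Polynomial.X ^ m := by
      apply Polynomial.toLaurent_injective
      rw [map_mul, map_mul, hp, hp', Polynomial.toLaurent_X_pow, Polynomial.toLaurent_X_pow,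
        mul_right_comm]
    rw [mapLeadingCoeff_apply, mapLeadingCoeff_apply,
      ← Polynomial.leadingCoeff_mul_X_pow (p := p') (n := n), this,
      Polynomial.leadingCoeff_mul_X_pow]
  have hl' : ∀ p : k[X], l (Polynomial.toLaurent p) = mapLeadingCoeff π p := fun p =>
    hl (n := 0) (by simp)
  refine ⟨⟨⟨l, ?_⟩, ?_, fun f g => ?_⟩, fun f hf => ?_, fun c => ?_, fun q hq f => ?_⟩
  · simpa using hl' 0
  · simpa using hl' 1
  · change l (f * g) = l f * l g
    obtain ⟨n, p, hp⟩ := f.exists_T_pow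
    obtain ⟨m, p', hp'⟩ := g.exists_T_pow
    rw [hl hp, hl hp', ← map_mul]
    apply hl (n := n + m)
    rw [map_mul, hp, hp', Nat.cast_add, LaurentPolynomial.T_add, mul_mul_mul_comm]
  · obtain ⟨n, p, hp⟩ := f.exists_T_pow
    have h0 := eq_zero_of_mapLeadingCoeff_eq_zero hπ p ((hl hp).symm.trans hf)
    rw [h0, map_zero, eq_comm] at hp
    exact (LaurentPolynomial.isUnit_T (n : ℤ)).mul_left_eq_zero.mp hp
  · change l _ = _
    rw [← mapLeadingCoeff_algebraMap, ← hl']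
    rw [← Polynomial.C_eq_algebraMap, Polynomial.toLaurent_C, LaurentPolynomial.C_eq_algebraMap]
  · change l _ = l _
    obtain ⟨n, p, hp⟩ := f.exists_T_pow
    -- The constant compensates for the scaling of the denominator `h ^ n`; `π` sends it to one.
    have h1 : Polynomial.toLaurent (sigmaQ q p * Polynomial.C (((q ^ n)⁻¹ : kˣ) : k)) =
        sigmaQLaurent q f * LaurentPolynomial.T n := by
      rw [map_mul, ← sigmaQLaurent_toLaurent, hp, map_mul, sigmaQLaurent_T,
        Polynomial.toLaurent_C, mul_assoc, mul_comm (_ • _), ← LaurentPolynomial.smul_eq_C_mul,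
        smul_smul, ← Units.val_mul, zpow_natCast, inv_mul_cancel, Units.val_one, one_smul]
    have hqn : π (((q ^ n)⁻¹ : kˣ) : k) = 1 := by
      rw [Units.val_inv_eq_inv_val, map_inv₀, Units.val_pow_eq_pow_val, map_pow, hq, one_pow,
        inv_one]
    rw [hl h1, hl hp, map_mul, mapLeadingCoeff_sigmaQ π hq, mapLeadingCoeff_apply π (.C _),
      Polynomial.leadingCoeff_C, hqn, mul_one]

end LeadingCoefficients

/-! ### Separating the families -/

section Classification

universe u

variable {k : Type u} [Field k]

theorem GWA.x_mul_coeff_X_ne (a : k[X]) :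
    GWA.x (sigmaCl k) a * GWA.coeff (sigmaCl k) a Polynomial.X ≠
      GWA.coeff (sigmaCl k) a Polynomial.X * GWA.x (sigmaCl k) a := by
  intro h
  rw [GWA.x_mul_coeff, sigmaCl_apply, Polynomial.X_comp, map_sub, map_one, sub_mul, one_mul,
    sub_eq_self] at h
  exact GWA.x_ne_zero h

/-- A classical GWA is not Morita equivalent to a GWA over a domain with an automorphism that is
either trivial or has a nontrivial eigenvalue. -/
theorem not_isMoritaEquivalent_classicalGWA {R : Type u} [CommRing R] [IsDomain R] [Algebra k R]
    {q : kˣ} {σ : R ≃ₐ[k] R} (hσ : q = 1 → σ = AlgEquiv.refl) {r : R} (hr : r ≠ 0)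
    (hrq : σ r = algebraMap k R q * r) {a₁ : k[X]} (ha₁ : a₁ ≠ 0) {a₂ : R} (ha₂ : a₂ ≠ 0) :
    ¬ IsMoritaEquivalent k (ClassicalGWA a₁) (GWA σ a₂) := by
  intro h
  obtain ⟨Γ, _, π, hπ, hker⟩ := exists_monoidWithZeroHom_ker (⊥ : Subgroup kˣ)
  have hq := GWA.map_eigenvalue_eq_one h.symm ha₂ ha₁ (mapLeadingCoeff π)
    (eq_zero_of_mapLeadingCoeff_eq_zero hπ) (mapLeadingCoeff_sigmaCl π) hr hrq
  rw [mapLeadingCoeff_algebraMap, hker, Subgroup.mem_bot] at hq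
  obtain rfl := hσ hq
  have := GWA.noZeroDivisors (σ := sigmaCl k) ha₁
  have := GWA.noZeroDivisors (σ := (AlgEquiv.refl : R ≃ₐ[k] R)) ha₂
  exact GWA.x_mul_coeff_X_ne a₁ (h.mul_comm_of_mul_comm GWA.mul_comm_of_eq_refl _ _)

theorem mem_zpowers_of_isMoritaEquivalent_quantumGWA {q₁ q₂ : kˣ} {a₁ a₂ : k[X]} (ha₁ : a₁ ≠ 0)
    (ha₂ : a₂ ≠ 0) (h : IsMoritaEquivalent k (QuantumGWA q₁ a₁) (QuantumGWA q₂ a₂)) :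
    q₁ ∈ Subgroup.zpowers q₂ := by
  obtain ⟨Γ, _, π, hπ, hker⟩ := exists_monoidWithZeroHom_ker (Subgroup.zpowers q₂)
  have hq := GWA.map_eigenvalue_eq_one h ha₁ ha₂ (mapLeadingCoeff π)
    (eq_zero_of_mapLeadingCoeff_eq_zero hπ)
    (mapLeadingCoeff_sigmaQ π ((hker q₂).mpr (Subgroup.mem_zpowers q₂)))
    Polynomial.X_ne_zero (sigmaQ_X q₁)
  rwa [mapLeadingCoeff_algebraMap, hker] at hq

theorem sigmaQLaurent_T_one (q : kˣ) : sigmaQLaurent q (LaurentPolynomial.T 1) =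
    algebraMap k k[T;T⁻¹] q * LaurentPolynomial.T 1 := by
  rw [sigmaQLaurent_T, zpow_one, Algebra.smul_def]

theorem mem_zpowers_of_isMoritaEquivalent_laurentQuantumGWA {q₁ q₂ : kˣ} {a₁ a₂ : k[T;T⁻¹]}
    (ha₁ : a₁ ≠ 0) (ha₂ : a₂ ≠ 0)
    (h : IsMoritaEquivalent k (LaurentQuantumGWA q₁ a₁) (LaurentQuantumGWA q₂ a₂)) :
    q₁ ∈ Subgroup.zpowers q₂ := by
  obtain ⟨Γ, _, π, hπ, hker⟩ := exists_monoidWithZeroHom_ker (Subgroup.zpowers q₂)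
  obtain ⟨l, hl, hlc, hlσ⟩ := exists_laurent_mapLeadingCoeff π hπ
  have hq := GWA.map_eigenvalue_eq_one h ha₁ ha₂ l hl
    (hlσ q₂ ((hker q₂).mpr (Subgroup.mem_zpowers q₂)))
    (LaurentPolynomial.isUnit_T 1).ne_zero (sigmaQLaurent_T_one q₁)
  rwa [hlc, hker] at hq

/-- If `q` is a root of unity, a power of `h` is central and `A'_q(a)` is not simple. -/
theorem not_isOfFinOrder_of_isSimpleRing {q : kˣ} {a : k[T;T⁻¹]}
    (h : IsSimpleRing (LaurentQuantumGWA q a)) : ¬ IsOfFinOrder q := by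
  intro hq
  obtain ⟨n, hn, hqn⟩ := hq.exists_pow_eq_one
  let t : k[T;T⁻¹] := LaurentPolynomial.T n - 1
  have hσt : ∀ p : kˣ, p ^ n = 1 → sigmaQLaurent p t = t := fun p hp => by
    rw [map_sub, map_one, sigmaQLaurent_T, zpow_natCast, hp, Units.val_one, one_smul]
  have ht0 : t ≠ 0 := fun h => by
    have := congrArg (fun f : k[T;T⁻¹] => f.coeff 0) h
    simp [t, ← LaurentPolynomial.T_zero, hn.ne'] at this
  let z := GWA.coeff (sigmaQLaurent q) a t
  have hz : z ∈ Subring.center (LaurentQuantumGWA q a) := by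
    refine Subring.mem_center_iff.mpr fun b => ?_
    induction b using GWA.induction with
    | coeff s => rw [← map_mul, ← map_mul, mul_comm]
    | x => rw [GWA.x_mul_coeff, hσt q hqn]
    | y => rw [GWA.y_mul_coeff, sigmaQLaurent_symm, hσt q⁻¹ (by rw [inv_pow, hqn, inv_one])]
    | mul b c hb hc => rw [mul_assoc, hc, ← mul_assoc, hb, mul_assoc]
    | add b c hb hc => rw [add_mul, mul_add, hb, hc]
  -- The centre of a simple ring is a field, so `h ^ n - 1` would be invertible in the GWA. The
  -- degree-zero coordinate of its inverse would invert it in `k[T;T⁻¹]`, which evaluation at `h =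
  -- 1` rules out.
  obtain ⟨⟨b, hb⟩, hzb⟩ := (IsSimpleRing.isField_center (LaurentQuantumGWA q a)).mul_inv_cancel
    (a := ⟨z, hz⟩) (fun h0 => ht0 (GWA.coeff_injective _ a
      ((congrArg Subtype.val h0).trans (map_zero _).symm)))
  have hzb' : z * b = 1 := congrArg Subtype.val hzb
  have h1 := congrArg (fun c => GWA.coord (sigmaQLaurent q) a c 0) hzb'
  rw [GWA.coord_mul, GWA.toEnd_coeff, GWA.coord_one, if_pos rfl] at h1
  have h2 := congrArg (LaurentPolynomial.eval₂ (RingHom.id k) 1) h1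
  simp [t] at h2

end Classification

theorem proposition3p1p3 (k : Type*) [Field k] [IsAlgClosed k] [CharZero k] :
    ((∀ a₁ : k[X], a₁ ≠ 0 → ∀ q : kˣ,
        (∀ a₂ : k[X], a₂ ≠ 0 →
          ¬ IsMoritaEquivalent k (ClassicalGWA a₁) (QuantumGWA q a₂)) ∧
        (∀ a₂ : k[T;T⁻¹], a₂ ≠ 0 →
          ¬ IsMoritaEquivalent k (ClassicalGWA a₁) (LaurentQuantumGWA q a₂))) ∧
      (∀ (q₁ q₂ : kˣ) (a₁ a₂ : k[X]), a₁ ≠ 0 → a₂ ≠ 0 →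
        IsMoritaEquivalent k (QuantumGWA q₁ a₁) (QuantumGWA q₂ a₂) →
        Subgroup.zpowers q₁ = Subgroup.zpowers q₂) ∧
      (∀ (q₁ q₂ : kˣ) (a₁ a₂ : k[T;T⁻¹]), a₁ ≠ 0 → a₂ ≠ 0 →
        IsSimpleRing (LaurentQuantumGWA q₁ a₁) → IsSimpleRing (LaurentQuantumGWA q₂ a₂) →
        IsMoritaEquivalent k (LaurentQuantumGWA q₁ a₁) (LaurentQuantumGWA q₂ a₂) →
        q₂ = q₁ ∨ q₂ = q₁⁻¹)) := by
  refine ⟨fun a₁ ha₁ q => ⟨fun a₂ ha₂ => ?_, fun a₂ ha₂ => ?_⟩, fun q₁ q₂ a₁ a₂ ha₁ ha₂ h => ?_,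
    fun q₁ q₂ a₁ a₂ ha₁ ha₂ hs _ h => ?_⟩
  · exact not_isMoritaEquivalent_classicalGWA (fun hq => hq ▸ sigmaQ_one) Polynomial.X_ne_zero
      (sigmaQ_X q) ha₁ ha₂
  · exact not_isMoritaEquivalent_classicalGWA (fun hq => hq ▸ sigmaQLaurent_one)
      (LaurentPolynomial.isUnit_T 1).ne_zero (sigmaQLaurent_T_one q) ha₁ ha₂
  · exact le_antisymm
      (Subgroup.zpowers_le.mpr (mem_zpowers_of_isMoritaEquivalent_quantumGWA ha₁ ha₂ h))
      (Subgroup.zpowers_le.mpr (mem_zpowers_of_isMoritaEquivalent_quantumGWA ha₂ ha₁ h.symm))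
  · have hz : Subgroup.zpowers q₁ = Subgroup.zpowers q₂ := le_antisymm
      (Subgroup.zpowers_le.mpr (mem_zpowers_of_isMoritaEquivalent_laurentQuantumGWA ha₁ ha₂ h))
      (Subgroup.zpowers_le.mpr
        (mem_zpowers_of_isMoritaEquivalent_laurentQuantumGWA ha₂ ha₁ h.symm))
    exact ((Subgroup.zpowers_eq_zpowers_iff (not_isOfFinOrder_of_isSimpleRing hs)).mp hz).imp
      Eq.symm Eq.symm
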